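/- Let $V$ be a complete discrete valuation ring. Algebras over $V$ may be non-unital, and $\otimes=\otimes_V$. For a $V$-algebra $R$ let $R^+=R\oplus V$ be its unitalisation (with unit $1=(0,1)$), let $\Omega^1(R)=R^+\otimes R$ and $\Omega^2(R)=R^+\otimes R\otimes R$ be the bimodules of noncommutative differential forms, spanned by the forms $x\,\mathrm dy$ and $x\,\mathrm dy\,\mathrm dz$ with $x\in R^+$, $y,z\in R$; $R$ acts on the left on the first tensor factor, and the right action is determined by the Leibniz rule, $(x\,\mathrm dy)a=x\,\mathrm d(ya)-xy\,\mathrm da$ and $(x\,\mathrm dy\,\mathrm dz)a=x\,\mathrm dy\,\mathrm d(za)-x\,\mathrm d(yz)\,\mathrm da+xy\,\mathrm dz\,\mathrm da$. A *connection* on $\Omega^1(R)$ is a $V$-linear map $\nabla\colon\Omega^1(R)\to\Omega^2(R)$ with $\nabla(a\omega)=a\nabla(\omega)$ and $\nabla(\omega a)=\nabla(\omega)a+\omega\,\mathrm da$ for all $a\in R$, $\omega\in\Omega^1(R)$. For a $V$-submodule $M\subseteq R$ put $M^{(n)}=\sum_{i=1}^n M^i$ (so $M^{(0)}=0$), and for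 $j=1,2$ and $r\in\mathbb N$ $$\mathcal F^M_r\Omega^j(R)=\sum_{i_0+\dots+i_j\le r}M^{(i_0)}\,\mathrm dM^{(i_1)}\cdots\mathrm dM^{(i_j)}\;\oplus\sum_{i_1+\dots+i_j\le r}\mathrm dM^{(i_1)}\cdots\mathrm dM^{(i_j)}.$$ The connection $\nabla$ *has finite degree on $M$* if there is $a\in\mathbb N$ with $\nabla(\mathcal F^M_r\Omega^1(R))\subseteq\mathcal F^M_{r+a}\Omega^2(R)$ for all $r\in\mathbb N$. Equip $R$ with the fine bornology: a subset is bounded if it is contained in a finitely generated $V$-submodule. The connection $\nabla$ *has finite degree* if every bounded subset of $R$ is contained in a bounded $V$-submodule on which $\nabla$ has finite degree. 1. Let $R$ be a (unital) commutative $V$-algebra that is smooth, finitely generated and of relative dimension $1$. Then $\Omega^1(R)$ admits a connection of finite degree. 2. Let $R$ be a $V$-algebra generated by a finite subset $S$. Assume that $R$ is quasi-free, that is, every square-zero extension $J\rightarrowtail E\twoheadrightarrow R$ of $V$-algebras that splits by a $V$-linear map also splits by a $V$-algebra homomorphism $R\to E$. Equip $A=R^+\otimes(R^+)^{\mathrm{op}}$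 with the filtration in which $\mathcal F_nA$ is the $V$-submodule generated by all products of at most $n$ elements of $\{s\otimes 1, 1\otimes s: s\in S\}$ (the empty product being $1$). Assume that $A$ is filtered Noetherian, that is, for every left ideal $I\subseteq A$ there are finitely many $x_1,\dots,x_k\in I$ and $l\in\mathbb N$ such that for all $m\in\mathbb N$ every $y\in\mathcal F_mA\cap I$ can be written as $y=\sum_{i=1}^k a_ix_i$ with $a_i\in\mathcal F_{m+l}A$. Then $\Omega^1(R)$ admits a connection of finite degree. -/

import Mathlib

open scoped TensorProduct

universe u v w

noncomputable section

namespace NCForms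

/-! ### Noncommutative differential forms of a possibly non-unital algebra

`V` is the base ring, `R` a possibly non-unital `V`-algebra, `R⁺ = Unitization V R`. -/

section Forms

variable (V : Type u) [CommRing V]
variable (R : Type v) [NonUnitalRing R] [Module V R] [IsScalarTower V R R] [SMulCommClass V R R]

/-- `Ω¹(R) = R⁺ ⊗ R`; the tensor `x ⊗ y` is the form `x dy`. -/
abbrev Omega1 : Type (max u v) := Unitization V R ⊗[V] R

/-- `Ω²(R) = R⁺ ⊗ R ⊗ R`; the tensor `x ⊗ y ⊗ z` is the form `x dy dz`. -/
abbrev Omega2 : Type (max u v) := Omega1 V R ⊗[V] R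

variable {R}

/-- If `P` carries a right multiplication by elements of `R`, this is the right multiplication on
forms `p dz`, `p ∈ P`, `z ∈ R`, dictated by the Leibniz rule:
`(p dz) · a = p d(z a) - (p · z) da`. -/
def rightMulStep {P : Type w} [AddCommGroup P] [Module V P] (ρ : P →ₗ[V] R →ₗ[V] P) :
    P ⊗[V] R →ₗ[V] R →ₗ[V] P ⊗[V] R :=
  LinearMap.mk₂ V
    (fun ω a => LinearMap.lTensor P (LinearMap.mulRight V a) ω - (TensorProduct.lift ρ ω) ⊗ₜ[V] a)
    (fun ω ω' a => by simp only [map_add, TensorProduct.add_tmul]; abel)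
    (fun c ω a => by simp only [map_smul, TensorProduct.smul_tmul', smul_sub])
    (fun ω a b => by
      have h : LinearMap.mulRight V (a + b) = LinearMap.mulRight V a + LinearMap.mulRight V b := by
        ext; simp [mul_add]
      rw [h, LinearMap.lTensor_add, LinearMap.add_apply, TensorProduct.tmul_add]; abel)
    (fun c ω a => by
      have h : LinearMap.mulRight V (c • a) = c • LinearMap.mulRight V a := by
        ext; simp [mul_smul_comm]
      rw [h, LinearMap.lTensor_smul, LinearMap.smul_apply, TensorProduct.tmul_smul, smul_sub])

variable (R)

/-- Right multiplication of `R⁺` by `R`. -/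
def rightMul0 : Unitization V R →ₗ[V] R →ₗ[V] Unitization V R :=
  (LinearMap.mul V (Unitization V R)).compl₂ (Unitization.inrHom V V R)

/-- Right multiplication on 1-forms: `(x dy) · a = x d(y a) - x y da`. -/
def rightMul1 : Omega1 V R →ₗ[V] R →ₗ[V] Omega1 V R := rightMulStep V (rightMul0 V R)

/-- Right multiplication on 2-forms: `(x dy dz) · a = x dy d(z a) - x d(y z) da + x y dz da`. -/
def rightMul2 : Omega2 V R →ₗ[V] R →ₗ[V] Omega2 V R := rightMulStep V (rightMul1 V R)

/-- A connection on `Ω¹(R)`: a `V`-linear map `∇ : Ω¹(R) → Ω²(R)` with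
`∇(a ω) = a ∇(ω)` and `∇(ω a) = ∇(ω) a + ω da`.  Left multiplication by `a ∈ R` acts on the first
tensor factor `R⁺`, and `ω da` is the tensor `ω ⊗ a` in `Ω²(R) = Ω¹(R) ⊗ R`. -/
structure Connection where
  toLinearMap : Omega1 V R →ₗ[V] Omega2 V R
  map_left_mul : ∀ (a : R) (ω : Omega1 V R),
    toLinearMap ((a : Unitization V R) • ω) = (a : Unitization V R) • toLinearMap ω
  map_right_mul : ∀ (ω : Omega1 V R) (a : R),
    toLinearMap (rightMul1 V R ω a) = rightMul2 V R (toLinearMap ω) a + ω ⊗ₜ[V] a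

/-! ### Filtrations and connections of finite degree -/

variable {V R}

/-- `posPow M i = M ^ (i + 1)`, the span of all products of `i + 1` elements of `M`. -/
def posPow (M : Submodule V R) : ℕ → Submodule V R
  | 0 => M
  | i + 1 => Submodule.map₂ (LinearMap.mul V R) M (posPow M i)

/-- `truncPow M n = M + M² + ⋯ + Mⁿ` (which is `0` for `n = 0`). -/
def truncPow (M : Submodule V R) (n : ℕ) : Submodule V R :=
  ⨆ i ∈ Finset.range n, posPow M i

/-- The `r`-th step of the filtration of 1-forms defined by `M`: the span of all `x dy` with
`x ∈ M⁽ⁱ⁾`, `y ∈ M⁽ʲ⁾`, `i + j ≤ r`, and of all `dy` with `y ∈ M⁽ʲ⁾`, `j ≤ r`. -/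
def filtration1 (M : Submodule V R) (r : ℕ) : Submodule V (Omega1 V R) :=
  Submodule.span V
    ({ω | ∃ i j : ℕ, i + j ≤ r ∧ ∃ x ∈ truncPow M i, ∃ y ∈ truncPow M j,
        ω = (x : Unitization V R) ⊗ₜ[V] y} ∪
     {ω | ∃ j : ℕ, j ≤ r ∧ ∃ y ∈ truncPow M j, ω = (1 : Unitization V R) ⊗ₜ[V] y})

/-- The `r`-th step of the filtration of 2-forms defined by `M`: the span of all `x dy dz` with
`x ∈ M⁽ⁱ⁾`, `y ∈ M⁽ʲ⁾`, `z ∈ M⁽ᵏ⁾`, `i + j + k ≤ r`, and of all `dy dz` with `y ∈ M⁽ʲ⁾`,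
`z ∈ M⁽ᵏ⁾`, `j + k ≤ r`. -/
def filtration2 (M : Submodule V R) (r : ℕ) : Submodule V (Omega2 V R) :=
  Submodule.span V
    ({ω | ∃ i j k : ℕ, i + j + k ≤ r ∧ ∃ x ∈ truncPow M i, ∃ y ∈ truncPow M j,
        ∃ z ∈ truncPow M k, ω = ((x : Unitization V R) ⊗ₜ[V] y) ⊗ₜ[V] z} ∪
     {ω | ∃ j k : ℕ, j + k ≤ r ∧ ∃ y ∈ truncPow M j, ∃ z ∈ truncPow M k,
        ω = ((1 : Unitization V R) ⊗ₜ[V] y) ⊗ₜ[V] z})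

/-- `∇` has finite degree on the submodule `M`: for some `a`, it maps the `r`-th filtration step
of 1-forms into the `(r + a)`-th filtration step of 2-forms, for all `r`. -/
def Connection.HasFiniteDegreeOn (D : Connection V R) (M : Submodule V R) : Prop :=
  ∃ a : ℕ, ∀ r : ℕ, ∀ ω ∈ filtration1 M r, D.toLinearMap ω ∈ filtration2 M (r + a)

variable (V) in
/-- Bounded subsets for the fine bornology: those contained in a finitely generated
`V`-submodule. -/
def IsFineBounded (B : Set R) : Prop := ∃ N : Submodule V R, N.FG ∧ B ⊆ N

/-- `∇` has finite degree on `R` with the fine bornology: every bounded subset is contained in a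
bounded submodule on which `∇` has finite degree. -/
def Connection.HasFiniteDegree (D : Connection V R) : Prop :=
  ∀ B : Set R, IsFineBounded V B →
    ∃ M : Submodule V R, IsFineBounded V (M : Set R) ∧ B ⊆ M ∧ D.HasFiniteDegreeOn M

/-! ### Quasi-free algebras -/

variable (V R)

/-- `R` is quasi-free: every square-zero extension `J ↣ E ↠ R` of `V`-algebras that splits by a
`V`-linear map splits by a `V`-algebra homomorphism. -/
def IsQuasiFree : Prop :=
  ∀ (E : Type (max u v)) [NonUnitalRing E] [Module V E] [IsScalarTower V E E]
    [SMulCommClass V E E] (p : E →ₙₐ[V] R) (σ : R →ₗ[V] E),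
    (∀ x : R, p (σ x) = x) → (∀ x y : E, p x = 0 → p y = 0 → x * y = 0) →
    ∃ s : R →ₙₐ[V] E, ∀ x : R, p (s x) = x

/-- The algebra `R⁺ ⊗ (R⁺)ᵒᵖ`. -/
abbrev Enveloping : Type (max u v) := Unitization V R ⊗[V] (Unitization V R)ᵐᵒᵖ

variable {R}

/-- The generating set `{s ⊗ 1} ∪ {1 ⊗ s}`, `s ∈ S`, of `R⁺ ⊗ (R⁺)ᵒᵖ` induced by a generating
set `S` of `R`. -/
def envelopingGenerators (S : Set R) : Set (Enveloping V R) :=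
  {t | ∃ s ∈ S, t = (s : Unitization V R) ⊗ₜ[V] (1 : (Unitization V R)ᵐᵒᵖ)} ∪
  {t | ∃ s ∈ S, t = (1 : Unitization V R) ⊗ₜ[V] MulOpposite.op (s : Unitization V R)}

end Forms

/-! ### Filtered Noetherian algebras -/

section FilteredNoetherian

variable (V : Type u) [CommRing V] {A : Type v} [Ring A] [Algebra V A]

/-- The filtration of a unital algebra by word length in `T`: the `n`-th step is the `V`-submodule
generated by all products of at most `n` elements of `T`; the empty product is `1`. -/
def wordFiltration (T : Set A) (n : ℕ) : Submodule V A :=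
  ⨆ i ∈ Finset.range (n + 1), Submodule.span V T ^ i

variable {V}

/-- A filtered algebra is (left) filtered Noetherian: for every left ideal `I` there are finitely
many `x₁, …, xₖ ∈ I` and `l ∈ ℕ` such that, for all `m`, every `y ∈ Fₘ ∩ I` is of the form
`∑ aᵢ xᵢ` with `aᵢ ∈ Fₘ₊ₗ`. -/
def IsFilteredNoetherian (F : ℕ → Submodule V A) : Prop :=
  ∀ I : Ideal A, ∃ (k : ℕ) (x : Fin k → A) (l : ℕ), (∀ i, x i ∈ I) ∧
    ∀ m : ℕ, ∀ y ∈ F m, y ∈ I →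
      ∃ a : Fin k → A, (∀ i, a i ∈ F (m + l)) ∧ y = ∑ i, a i * x i

end FilteredNoetherian

/-! ### Smooth algebras of a given relative dimension -/

/-- The commutative `V`-algebra `R` is smooth (hence of finite presentation) of relative
dimension `n`: it is standard smooth of relative dimension `n` locally on `Spec R`. -/
def IsSmoothOfRelativeDimension (n : ℕ) (V : Type u) [CommRing V] (R : Type v) [CommRing R]
    [Algebra V R] : Prop :=
  Algebra.Smooth V R ∧ ∃ s : Set R, Ideal.span s = ⊤ ∧
    ∀ t ∈ s, Algebra.IsStandardSmoothOfRelativeDimension n V (Localization.Away t)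

end NCForms

end

/-!
The theorem splits into the existence of a connection on `Ω¹(R)` and the bound on its degree.

*Degree.* Every connection on a finitely generated algebra has finite degree
(`Connection.hasFiniteDegree_of_adjoin_eq_top`). By left linearity `∇` is determined by the map
`φ(y) = ∇(dy)`, which satisfies `φ(ya) = y φ(a) + φ(y) a + dy da`. Let `M` be the span of a finite
generating set. Then `φ(M) ⊆ F_c Ω²` for some `c`, and since the filtrations are multiplicative,
induction on the word length gives `φ(M⁽ⁿ⁾) ⊆ F_{n+c+1} Ω²`. Passing from `M` to `M⁽ᵏ⁾` only
rescales the filtrations, and every bounded set lies in some `M⁽ᵏ⁾`.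

*Existence, quasi-free case.* The form-valued map `(x, y) ↦ dx dy` is a Hochschild 2-cocycle. The
square-zero extension of `R` by `Ω²(R)` that it defines splits, and the second component of a
multiplicative splitting is a map `φ` as above.

*Existence, smooth case.* Write `U = R⁺`, a commutative ring isomorphic to `V × R`. The bimodule
`Ω¹(R)` is the kernel `I` of the multiplication `U ⊗ U → U`. If `I` is a projective
`U ⊗ U`-module, then the bimodule surjection `U ⊗ U ⊗ R → I`, `x ⊗ u ⊗ y ↦ x (dy) u`, splits, and a
splitting followed by `x ⊗ u ⊗ y ↦ x dy du` is a connection (`exists_connection_of_projective`).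
Projectivity of `I` is checked at the primes `P` of the Noetherian ring `U ⊗ U`
(`projective_diagonal_unitization`). If `I ⊄ P`, then `I` is locally the unit ideal. If `P` lies over
the factor `V` of `U`, then `I = I²` locally and `I` vanishes locally by Nakayama's lemma. Otherwise
the Kähler differentials `I/I²` are locally free of rank one, and by Nakayama `I` is locally
generated by one element `f`. It is a nonzerodivisor: the derivation dual to the class of `f`
exponentiates, by formal smoothness, to homomorphisms from `U ⊗ U` to truncated polynomial rings
that map `f` to a unit multiple of the variable (`algebraMap_lmul'_eq_zero`), so the powers of `f`
are independent modulo `I`, and Krull's intersection theorem applies.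
-/

noncomputable section

namespace NCForms

/-! ### Powers of a generating submodule and the degree of a connection -/

section FiniteDegree

variable {V : Type u} [CommRing V]
variable {R : Type v} [NonUnitalRing R] [Module V R] [IsScalarTower V R R] [SMulCommClass V R R]

lemma mul_mem_posPow {M : Submodule V R} {i j : ℕ} {x y : R} (hx : x ∈ posPow M i)
    (hy : y ∈ posPow M j) : x * y ∈ posPow M (i + j + 1) := by
  induction i generalizing x with
  | zero =>
    rw [zero_add]
    exact Submodule.apply_mem_map₂ (LinearMap.mul V R) hx hy
  | succ i ih =>
    suffices h : posPow M (i + 1) ≤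
        (posPow M (i + 1 + j + 1)).comap (LinearMap.mulRight V y) from h hx
    refine Submodule.map₂_le.2 fun m hm z hz => ?_
    have h := Submodule.apply_mem_map₂ (LinearMap.mul V R) hm (ih hz)
    rw [show i + 1 + j + 1 = (i + j + 1) + 1 by ring]
    change m * z * y ∈ posPow M (i + j + 1 + 1)
    rw [mul_assoc]
    exact h

lemma posPow_add (M : Submodule V R) (i j : ℕ) :
    posPow M (i + j + 1) = Submodule.map₂ (LinearMap.mul V R) (posPow M i) (posPow M j) := by
  refine le_antisymm ?_ (Submodule.map₂_le.2 fun x hx y hy => mul_mem_posPow hx hy)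
  induction i with
  | zero => rw [zero_add]; exact le_rfl
  | succ i ih =>
    rw [show i + 1 + j + 1 = (i + j + 1) + 1 by ring]
    refine Submodule.map₂_le.2 fun m hm z hz => ?_
    suffices h : Submodule.map₂ (LinearMap.mul V R) (posPow M i) (posPow M j) ≤
        (Submodule.map₂ (LinearMap.mul V R) (posPow M (i + 1)) (posPow M j)).comap
          (LinearMap.mulLeft V m) from h (ih hz)
    refine Submodule.map₂_le.2 fun x hx y hy => ?_
    have h := Submodule.apply_mem_map₂ (LinearMap.mul V R)
      (Submodule.apply_mem_map₂ (LinearMap.mul V R) hm hx : m * x ∈ posPow M (i + 1)) hy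
    change m * (x * y) ∈ Submodule.map₂ (LinearMap.mul V R) (posPow M (i + 1)) (posPow M j)
    rw [← mul_assoc]
    exact h

lemma posPow_le_truncPow (M : Submodule V R) {i n : ℕ} (h : i < n) :
    posPow M i ≤ truncPow M n :=
  le_iSup₂_of_le i (Finset.mem_range.2 h) le_rfl

lemma truncPow_le {M N : Submodule V R} {n : ℕ} (h : ∀ i < n, posPow M i ≤ N) :
    truncPow M n ≤ N :=
  iSup₂_le fun i hi => h i (Finset.mem_range.1 hi)

lemma truncPow_mono (M : Submodule V R) {m n : ℕ} (h : m ≤ n) : truncPow M m ≤ truncPow M n :=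
  truncPow_le fun _ hi => posPow_le_truncPow M (hi.trans_le h)

lemma mul_mem_truncPow {M : Submodule V R} {m n : ℕ} {x y : R} (hx : x ∈ truncPow M m)
    (hy : y ∈ truncPow M n) : x * y ∈ truncPow M (m + n) := by
  suffices h : truncPow M m ≤ (truncPow M (m + n)).comap (LinearMap.mulRight V y) from h hx
  refine truncPow_le fun i hi x hx => ?_
  suffices h : truncPow M n ≤ (truncPow M (m + n)).comap (LinearMap.mulLeft V x) from h hy
  refine truncPow_le fun j hj y hy => ?_
  exact posPow_le_truncPow M (by omega) (mul_mem_posPow hx hy)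

lemma truncPow_one (M : Submodule V R) : truncPow M 1 = M := by
  simp [truncPow, posPow]

lemma truncPow_truncPow_le (M : Submodule V R) (k n : ℕ) :
    truncPow (truncPow M k) n ≤ truncPow M (k * n) := by
  refine truncPow_le fun i hi => ?_
  suffices h : posPow (truncPow M k) i ≤ truncPow M (k * (i + 1)) from
    h.trans (truncPow_mono M (Nat.mul_le_mul_left k hi))
  clear hi
  induction i with
  | zero => simp [posPow]
  | succ i ih =>
    refine Submodule.map₂_le.2 fun x hx y hy => ?_
    have := mul_mem_truncPow hx (ih hy)
    rwa [show k + k * (i + 1) = k * (i + 1 + 1) by ring] at this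

/-- A product of at most `k n` factors groups into at most `n` products of at most `k` factors. -/
lemma truncPow_le_truncPow_truncPow (M : Submodule V R) {k j n : ℕ} (h : j ≤ k * n) :
    truncPow M j ≤ truncPow (truncPow M k) n := by
  refine truncPow_le fun i hi => ?_
  replace hi : i < k * n := hi.trans_le h
  clear h
  induction n generalizing i with
  | zero => simp at hi
  | succ n ih =>
    by_cases hik : i < k
    · calc posPow M i ≤ truncPow M k := posPow_le_truncPow M hik
        _ = truncPow (truncPow M k) 1 := (truncPow_one _).symm
        _ ≤ _ := truncPow_mono _ (by omega)
    · obtain rfl | hk := Nat.eq_zero_or_pos k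
      · simp at hi
      have e : i = (k - 1) + (i - k) + 1 := by omega
      rw [e, posPow_add]
      refine Submodule.map₂_le.2 fun x hx y hy => ?_
      have hx' := posPow_le_truncPow M (show k - 1 < k by omega) hx
      have hy' := ih (i - k) (by rw [mul_add] at hi; omega) hy
      rw [← truncPow_one (truncPow M k)] at hx'
      have := mul_mem_truncPow hx' hy'
      rwa [add_comm 1] at this

lemma fg_truncPow {M : Submodule V R} (hM : M.FG) (n : ℕ) : (truncPow M n).FG := by
  refine Submodule.fg_biSup _ _ fun i hi => ?_
  clear hi
  induction i with
  | zero => exact hM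
  | succ i ih => exact Submodule.FG.map₂ _ hM ih

lemma exists_mem_truncPow {S : Set R} (hS : NonUnitalAlgebra.adjoin V S = ⊤) (x : R) :
    ∃ n, x ∈ truncPow (Submodule.span V S) n := by
  have hx : x ∈ NonUnitalAlgebra.adjoin V S := hS ▸ trivial
  induction hx using NonUnitalAlgebra.adjoin_induction with
  | mem x hx => exact ⟨1, by rw [truncPow_one]; exact Submodule.subset_span hx⟩
  | add x y _ _ hx hy =>
    obtain ⟨m, hm⟩ := hx
    obtain ⟨n, hn⟩ := hy
    exact ⟨max m n, add_mem (truncPow_mono _ (le_max_left _ _) hm)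
      (truncPow_mono _ (le_max_right _ _) hn)⟩
  | zero => exact ⟨0, zero_mem _⟩
  | mul x y _ _ hx hy =>
    obtain ⟨m, hm⟩ := hx
    obtain ⟨n, hn⟩ := hy
    exact ⟨m + n, mul_mem_truncPow hm hn⟩
  | smul r x _ hx =>
    obtain ⟨m, hm⟩ := hx
    exact ⟨m, Submodule.smul_mem _ _ hm⟩

/-- A finitely generated submodule lies in one step of an exhaustive increasing filtration. -/
lemma exists_le_of_fg {N : Type*} [AddCommMonoid N] [Module V N] {F : ℕ → Submodule V N}
    (hF : Monotone F) (h : ∀ x, ∃ n, x ∈ F n) {K : Submodule V N} (hK : K.FG) :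
    ∃ n, K ≤ F n := by
  obtain ⟨s, rfl⟩ := hK
  choose n hn using h
  exact ⟨s.sup n, Submodule.span_le.2 fun x hx => hF (Finset.le_sup hx) (hn x)⟩

lemma filtration2_mono (M : Submodule V R) : Monotone (filtration2 M) := by
  intro r s hrs
  refine Submodule.span_mono ?_
  rintro _ (⟨i, j, k, h, H⟩ | ⟨j, k, h, H⟩)
  · exact .inl ⟨i, j, k, h.trans hrs, H⟩
  · exact .inr ⟨j, k, h.trans hrs, H⟩

lemma sub_mem_filtration2 {M : Submodule V R} {r : ℕ} {ω η : Omega2 V R}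
    (hω : ω ∈ filtration2 M r) (hη : η ∈ filtration2 M r) : ω - η ∈ filtration2 M r := by
  have h := add_mem hω (Submodule.smul_mem _ (-1 : V) hη)
  have e : (-1 : V) • η = -η := neg_one_smul V η
  rw [e] at h
  rwa [sub_eq_add_neg]

lemma tmul_tmul_mem_filtration2 {M : Submodule V R} {i j k : ℕ} {x y z : R}
    (hx : x ∈ truncPow M i) (hy : y ∈ truncPow M j) (hz : z ∈ truncPow M k) :
    ((x : Unitization V R) ⊗ₜ[V] y) ⊗ₜ[V] z ∈ filtration2 M (i + j + k) :=
  Submodule.subset_span (.inl ⟨i, j, k, le_rfl, x, hx, y, hy, z, hz, rfl⟩)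

lemma one_tmul_tmul_mem_filtration2 {M : Submodule V R} {j k : ℕ} {y z : R}
    (hy : y ∈ truncPow M j) (hz : z ∈ truncPow M k) :
    ((1 : Unitization V R) ⊗ₜ[V] y) ⊗ₜ[V] z ∈ filtration2 M (j + k) :=
  Submodule.subset_span (.inr ⟨j, k, le_rfl, y, hy, z, hz, rfl⟩)

/-- The filtration of 2-forms is multiplicative for the left action of `R`. -/
lemma smul_mem_filtration2 {M : Submodule V R} {i r : ℕ} {x : R} (hx : x ∈ truncPow M i)
    {ω : Omega2 V R} (hω : ω ∈ filtration2 M r) :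
    (x : Unitization V R) • ω ∈ filtration2 M (i + r) := by
  induction hω using Submodule.span_induction with
  | mem ω h =>
    obtain ⟨i', j, k, h, x', hx', y, hy, z, hz, rfl⟩ | ⟨j, k, h, y, hy, z, hz, rfl⟩ := h
    · rw [TensorProduct.smul_tmul', TensorProduct.smul_tmul', smul_eq_mul, ← Unitization.inr_mul]
      exact filtration2_mono M (by omega)
        (tmul_tmul_mem_filtration2 (mul_mem_truncPow hx hx') hy hz)
    · rw [TensorProduct.smul_tmul', TensorProduct.smul_tmul', smul_eq_mul, mul_one]
      exact filtration2_mono M (by omega) (tmul_tmul_mem_filtration2 hx hy hz)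
  | zero => rw [smul_zero]; exact zero_mem _
  | add ω η _ _ h₁ h₂ => rw [smul_add]; exact add_mem h₁ h₂
  | smul c ω _ h => rw [smul_comm]; exact Submodule.smul_mem _ _ h

@[simp]
lemma rightMulStep_tmul {P : Type w} [AddCommGroup P] [Module V P] (ρ : P →ₗ[V] R →ₗ[V] P)
    (p : P) (z a : R) :
    rightMulStep V ρ (p ⊗ₜ z) a = p ⊗ₜ[V] (z * a) - ρ p z ⊗ₜ[V] a := by
  simp [rightMulStep]

@[simp]
lemma rightMul0_apply (x : Unitization V R) (a : R) :
    rightMul0 V R x a = x * (a : Unitization V R) := by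
  simp [rightMul0]

@[simp]
lemma rightMul1_tmul (x : Unitization V R) (y a : R) :
    rightMul1 V R (x ⊗ₜ y) a = x ⊗ₜ[V] (y * a) - (x * (y : Unitization V R)) ⊗ₜ[V] a := by
  simp [rightMul1]

@[simp]
lemma rightMul2_tmul (ω : Omega1 V R) (z a : R) :
    rightMul2 V R (ω ⊗ₜ z) a = ω ⊗ₜ[V] (z * a) - rightMul1 V R ω z ⊗ₜ[V] a := by
  simp [rightMul2]

/-- The filtration of 2-forms is multiplicative for the right action of `R`: all terms of the
Leibniz rule have the same total degree. -/
lemma rightMul2_mem_filtration2 {M : Submodule V R} {n r : ℕ} {a : R} (ha : a ∈ truncPow M n)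
    {ω : Omega2 V R} (hω : ω ∈ filtration2 M r) :
    rightMul2 V R ω a ∈ filtration2 M (r + n) := by
  induction hω using Submodule.span_induction with
  | mem ω h =>
    obtain ⟨i, j, k, h, x, hx, y, hy, z, hz, rfl⟩ | ⟨j, k, h, y, hy, z, hz, rfl⟩ := h
    · rw [rightMul2_tmul, rightMul1_tmul, TensorProduct.sub_tmul, ← Unitization.inr_mul]
      refine sub_mem_filtration2 ?_ (sub_mem_filtration2 ?_ ?_)
      · exact filtration2_mono M (by omega)
          (tmul_tmul_mem_filtration2 hx hy (mul_mem_truncPow hz ha))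
      · exact filtration2_mono M (by omega)
          (tmul_tmul_mem_filtration2 hx (mul_mem_truncPow hy hz) ha)
      · exact filtration2_mono M (by omega)
          (tmul_tmul_mem_filtration2 (mul_mem_truncPow hx hy) hz ha)
    · rw [rightMul2_tmul, rightMul1_tmul, TensorProduct.sub_tmul, one_mul]
      refine sub_mem_filtration2 ?_ (sub_mem_filtration2 ?_ ?_)
      · exact filtration2_mono M (by omega)
          (one_tmul_tmul_mem_filtration2 hy (mul_mem_truncPow hz ha))
      · exact filtration2_mono M (by omega)
          (one_tmul_tmul_mem_filtration2 (mul_mem_truncPow hy hz) ha)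
      · exact filtration2_mono M (by omega) (tmul_tmul_mem_filtration2 hy hz ha)
  | zero => simp
  | add ω η _ _ h₁ h₂ => rw [map_add, LinearMap.add_apply]; exact add_mem h₁ h₂
  | smul c ω _ h => rw [map_smul, LinearMap.smul_apply]; exact Submodule.smul_mem _ _ h

lemma exists_mem_filtration2 {M : Submodule V R} (hM : ∀ x, ∃ n, x ∈ truncPow M n)
    (ω : Omega2 V R) : ∃ r, ω ∈ filtration2 M r := by
  have hadd : ∀ {ω η : Omega2 V R}, (∃ r, ω ∈ filtration2 M r) → (∃ r, η ∈ filtration2 M r) →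
      ∃ r, ω + η ∈ filtration2 M r := fun ⟨r, hr⟩ ⟨s, hs⟩ =>
    ⟨max r s, add_mem (filtration2_mono M (le_max_left _ _) hr)
      (filtration2_mono M (le_max_right _ _) hs)⟩
  induction ω using TensorProduct.induction_on with
  | zero => exact ⟨0, zero_mem _⟩
  | add ω η h₁ h₂ => exact hadd h₁ h₂
  | tmul ω z =>
    induction ω using TensorProduct.induction_on with
    | zero => exact ⟨0, by simp⟩
    | add ω η h₁ h₂ => rw [TensorProduct.add_tmul]; exact hadd h₁ h₂
    | tmul x y =>
      induction x using Unitization.ind with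
      | inl_add_inr c x =>
        obtain ⟨i, hi⟩ := hM x
        obtain ⟨j, hj⟩ := hM y
        obtain ⟨k, hk⟩ := hM z
        rw [TensorProduct.add_tmul, TensorProduct.add_tmul]
        refine hadd ⟨j + k, ?_⟩ ⟨_, tmul_tmul_mem_filtration2 hi hj hk⟩
        have : (Unitization.inl c : Unitization V R) = c • 1 := by
          ext <;> simp
        rw [this, ← TensorProduct.smul_tmul', ← TensorProduct.smul_tmul']
        exact Submodule.smul_mem _ _ (one_tmul_tmul_mem_filtration2 hj hk)

/-- A connection is determined by its values on exact forms `dy`, and those obey a twisted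
Leibniz rule. -/
lemma Connection.map_one_tmul_mul (D : Connection V R) (y a : R) :
    D.toLinearMap (1 ⊗ₜ[V] (y * a)) =
      (y : Unitization V R) • D.toLinearMap (1 ⊗ₜ[V] a) +
        rightMul2 V R (D.toLinearMap (1 ⊗ₜ[V] y)) a + (1 ⊗ₜ[V] y) ⊗ₜ[V] a := by
  have h := D.map_right_mul (1 ⊗ₜ[V] y) a
  rw [rightMul1_tmul, map_sub, one_mul, sub_eq_iff_eq_add] at h
  rw [h, ← D.map_left_mul, TensorProduct.smul_tmul', smul_eq_mul, mul_one]
  abel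

/-- If a finitely generated submodule generates `R`, then every connection has finite degree on
it: by the Leibniz rule, `∇(dy)` for a product `y` of generators is a sum of terms in which `∇`
meets a single generator, and each of these raises the degree by at most a fixed constant. -/
lemma Connection.hasFiniteDegreeOn_of_fg (D : Connection V R) {M : Submodule V R} (hfg : M.FG)
    (hM : ∀ x, ∃ n, x ∈ truncPow M n) : D.HasFiniteDegreeOn M := by
  let φ : R →ₗ[V] Omega2 V R := D.toLinearMap ∘ₗ TensorProduct.mk V (Unitization V R) R 1
  have hφa : ∀ y, φ y = D.toLinearMap (1 ⊗ₜ[V] y) := fun y => rfl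
  obtain ⟨c, hc⟩ : ∃ c, M.map φ ≤ filtration2 M c :=
    exists_le_of_fg (filtration2_mono M) (exists_mem_filtration2 hM) (hfg.map φ)
  -- The shift is `c + 1` rather than `c` because of the term `ds da`, of degree `i + 2` for
  -- `a ∈ M ^ (i + 1)`, which has to be covered even when `c = 0`.
  have key : ∀ i, posPow M i ≤ (filtration2 M (i + (c + 1))).comap φ := by
    intro i
    induction i with
    | zero =>
      intro y hy
      have h : φ y ∈ filtration2 M c := hc (Submodule.mem_map_of_mem hy)
      exact filtration2_mono M (show c ≤ 0 + (c + 1) by omega) h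
    | succ i ih =>
      refine Submodule.map₂_le.2 fun s hs a ha => ?_
      have hs' : s ∈ truncPow M 1 := by rwa [truncPow_one]
      have ha' : a ∈ truncPow M (i + 1) := posPow_le_truncPow M (Nat.lt_succ_self i) ha
      change φ (s * a) ∈ filtration2 M (i + 1 + (c + 1))
      rw [hφa, D.map_one_tmul_mul, ← hφa, ← hφa]
      refine add_mem (add_mem ?_ ?_) ?_
      · exact filtration2_mono M (by omega) (smul_mem_filtration2 hs' (ih ha))
      · exact filtration2_mono M (by omega)
          (rightMul2_mem_filtration2 ha' (hc (Submodule.mem_map_of_mem hs)))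
      · exact filtration2_mono M (by omega) (one_tmul_tmul_mem_filtration2 hs' ha')
  have key' : ∀ n, truncPow M n ≤ (filtration2 M (n + (c + 1))).comap φ := fun n =>
    truncPow_le fun i hi => (key i).trans
      (Submodule.comap_mono (filtration2_mono M (by omega)))
  refine ⟨c + 1, fun r => ?_⟩
  suffices h : filtration1 M r ≤ (filtration2 M (r + (c + 1))).comap D.toLinearMap from
    fun ω hω => h hω
  refine Submodule.span_le.2 ?_
  rintro _ (⟨i, j, h, x, hx, y, hy, rfl⟩ | ⟨j, h, y, hy, rfl⟩)
  · have e : (x : Unitization V R) ⊗ₜ[V] y = (x : Unitization V R) • (1 ⊗ₜ[V] y) := by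
      rw [TensorProduct.smul_tmul', smul_eq_mul, mul_one]
    change D.toLinearMap ((x : Unitization V R) ⊗ₜ[V] y) ∈ filtration2 M (r + (c + 1))
    rw [e, D.map_left_mul]
    exact filtration2_mono M (by omega) (smul_mem_filtration2 hx (key' j hy))
  · exact filtration2_mono M (by omega) (key' j hy)

/-- Replacing `M` by `M + ⋯ + Mᵏ` rescales the filtrations by `k`, up to a bounded shift. -/
lemma Connection.HasFiniteDegreeOn.truncPow {D : Connection V R} {M : Submodule V R}
    (h : D.HasFiniteDegreeOn M) {k : ℕ} (hk : 0 < k) :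
    D.HasFiniteDegreeOn (truncPow M k) := by
  obtain ⟨a, ha⟩ := h
  refine ⟨a + 3, fun r ω hω => ?_⟩
  have h₁ : filtration1 (NCForms.truncPow M k) r ≤ filtration1 M (k * r) := by
    refine Submodule.span_mono ?_
    rintro _ (⟨i, j, h, x, hx, y, hy, rfl⟩ | ⟨j, h, y, hy, rfl⟩)
    · exact .inl ⟨k * i, k * j, by rw [← mul_add]; exact Nat.mul_le_mul_left k h,
        x, truncPow_truncPow_le M k i hx, y, truncPow_truncPow_le M k j hy, rfl⟩
    · exact .inr ⟨k * j, Nat.mul_le_mul_left k h, y, truncPow_truncPow_le M k j hy, rfl⟩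
  -- `M⁽ⁱ⁾` lies in step `⌊i/k⌋ + 1` of the coarser filtration, so each factor costs one step.
  have hstep : ∀ i, NCForms.truncPow M i ≤ NCForms.truncPow (NCForms.truncPow M k) (i / k + 1) :=
    fun i => truncPow_le_truncPow_truncPow M (Nat.lt_mul_div_succ i hk).le
  have hdiv : ∀ m, m ≤ k * r + a → m / k ≤ r + a := fun m hm =>
    Nat.div_le_of_le_mul (hm.trans (by nlinarith))
  have h₂ : filtration2 M (k * r + a) ≤ filtration2 (NCForms.truncPow M k) (r + (a + 3)) := by
    refine Submodule.span_mono ?_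
    rintro _ (⟨i, j, l, h, x, hx, y, hy, z, hz, rfl⟩ | ⟨j, l, h, y, hy, z, hz, rfl⟩)
    · refine .inl ⟨_, _, _, ?_, x, hstep i hx, y, hstep j hy, z, hstep l hz, rfl⟩
      have := hdiv _ h
      have := Nat.div_add_div_le_add_div (x := i + j) (y := l) (z := k)
      have := Nat.div_add_div_le_add_div (x := i) (y := j) (z := k)
      omega
    · refine .inr ⟨_, _, ?_, y, hstep j hy, z, hstep l hz, rfl⟩
      have := hdiv _ h
      have := Nat.div_add_div_le_add_div (x := j) (y := l) (z := k)
      omega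
  exact h₂ (ha _ ω (h₁ hω))

/-- Every connection on a finitely generated algebra has finite degree. -/
theorem Connection.hasFiniteDegree_of_adjoin_eq_top (D : Connection V R) {S : Set R}
    (hfin : S.Finite) (hS : NonUnitalAlgebra.adjoin V S = ⊤) : D.HasFiniteDegree := by
  have hfg : (Submodule.span V S).FG := Submodule.fg_span hfin
  have hD := D.hasFiniteDegreeOn_of_fg hfg (exists_mem_truncPow hS)
  rintro B ⟨N, hN, hB⟩
  obtain ⟨k, hk⟩ := exists_le_of_fg (F := truncPow (Submodule.span V S))
    (fun _ _ h => truncPow_mono _ h) (exists_mem_truncPow hS) hN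
  exact ⟨truncPow _ (k + 1), ⟨_, fg_truncPow hfg _, subset_rfl⟩,
    hB.trans (hk.trans (truncPow_mono _ k.le_succ)), hD.truncPow k.succ_pos⟩

end FiniteDegree

/-! ### The bimodule of 2-forms and its cocycle extension -/

section Bimodule

variable {V : Type u} [CommRing V]
variable {R : Type v} [NonUnitalRing R] [Module V R] [IsScalarTower V R R] [SMulCommClass V R R]

lemma rightMulStep_smul {U : Type*} [Semiring U] [Algebra V U] {P : Type w} [AddCommGroup P]
    [Module V P] [Module U P] [IsScalarTower V U P] {ρ : P →ₗ[V] R →ₗ[V] P}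
    (hρ : ∀ (x : U) p a, ρ (x • p) a = x • ρ p a) (x : U) (ω : P ⊗[V] R) (a : R) :
    rightMulStep V ρ (x • ω) a = x • rightMulStep V ρ ω a := by
  induction ω using TensorProduct.induction_on with
  | zero => simp
  | add ω η h₁ h₂ => simp only [smul_add, map_add, LinearMap.add_apply, h₁, h₂]
  | tmul p z => simp only [TensorProduct.smul_tmul', rightMulStep_tmul, hρ, smul_sub]

lemma rightMulStep_mul {P : Type w} [AddCommGroup P] [Module V P] {ρ : P →ₗ[V] R →ₗ[V] P}
    (hρ : ∀ p a b, ρ (ρ p a) b = ρ p (a * b)) (ω : P ⊗[V] R) (a b : R) :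
    rightMulStep V ρ (rightMulStep V ρ ω a) b = rightMulStep V ρ ω (a * b) := by
  induction ω using TensorProduct.induction_on with
  | zero => simp
  | add ω η h₁ h₂ => simp only [map_add, LinearMap.add_apply, h₁, h₂]
  | tmul p z => simp [hρ, mul_assoc]

lemma rightMul1_smul (x : Unitization V R) (ω : Omega1 V R) (a : R) :
    rightMul1 V R (x • ω) a = x • rightMul1 V R ω a :=
  rightMulStep_smul (fun x p a => by simp [mul_assoc]) x ω a

lemma rightMul2_smul (x : Unitization V R) (ω : Omega2 V R) (a : R) :
    rightMul2 V R (x • ω) a = x • rightMul2 V R ω a := by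
  induction ω using TensorProduct.induction_on with
  | zero => simp
  | add ω η h₁ h₂ => simp only [smul_add, map_add, LinearMap.add_apply, h₁, h₂]
  | tmul p z =>
    simp only [TensorProduct.smul_tmul', rightMul2_tmul, rightMul1_smul]
    rw [smul_sub]
    rfl

lemma rightMul2_mul (ω : Omega2 V R) (a b : R) :
    rightMul2 V R (rightMul2 V R ω a) b = rightMul2 V R ω (a * b) :=
  rightMulStep_mul (rightMulStep_mul fun p a b => by simp [mul_assoc]) ω a b

/-- A linear map `φ : R → Ω²(R)` with `φ(ya) = y φ(a) + φ(y) a + dy da` extends to the connection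
`∇(x dy) = x φ(y)`. -/
def Connection.ofLeibniz (φ : R →ₗ[V] Omega2 V R)
    (hφ : ∀ y a, φ (y * a) =
      (y : Unitization V R) • φ a + rightMul2 V R (φ y) a + (1 ⊗ₜ[V] y) ⊗ₜ[V] a) :
    Connection V R where
  toLinearMap := TensorProduct.lift <| LinearMap.mk₂ V (fun x y => x • φ y)
    (fun x x' y => add_smul x x' _) (fun c x y => smul_assoc c x _)
    (fun x y y' => by rw [map_add, smul_add])
    (fun c x y => by rw [map_smul, smul_comm])
  map_left_mul a ω := by
    induction ω using TensorProduct.induction_on with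
    | zero => simp
    | add ω η h₁ h₂ => simp only [smul_add, map_add, h₁, h₂]
    | tmul x y =>
      simp only [TensorProduct.smul_tmul', TensorProduct.lift.tmul, LinearMap.mk₂_apply,
        smul_eq_mul, mul_smul]
  map_right_mul ω a := by
    induction ω using TensorProduct.induction_on with
    | zero => simp
    | add ω η h₁ h₂ =>
      simp only [map_add, LinearMap.add_apply, TensorProduct.add_tmul, h₁, h₂]
      abel
    | tmul x y =>
      simp only [rightMul1_tmul, map_sub, TensorProduct.lift.tmul, LinearMap.mk₂_apply, hφ,
        rightMul2_smul, smul_add, mul_smul]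
      simp only [TensorProduct.smul_tmul', smul_eq_mul, mul_one]
      abel

end Bimodule

section Extension

variable {V : Type u} [CommRing V] {R : Type v} [NonUnitalRing R] [Module V R]

variable (V R) in
/-- The square-zero extension of `R` by `Ω²(R)` with the cocycle `(x, y) ↦ dx dy`: the module
`R ⊕ Ω²(R)` with product `(x, ω)(y, η) = (xy, xη + ωy + dx dy)`. -/
def CocycleExtension : Type (max u v) := R × Omega2 V R

namespace CocycleExtension

instance : AddCommGroup (CocycleExtension V R) := inferInstanceAs (AddCommGroup (R × Omega2 V R))

instance : Module V (CocycleExtension V R) := inferInstanceAs (Module V (R × Omega2 V R))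

@[ext]
lemma ext {p q : CocycleExtension V R} (h₁ : p.1 = q.1) (h₂ : p.2 = q.2) : p = q :=
  Prod.ext h₁ h₂

@[simp] lemma fst_zero : (0 : CocycleExtension V R).1 = 0 := rfl
@[simp] lemma snd_zero : (0 : CocycleExtension V R).2 = 0 := rfl
@[simp] lemma fst_add (p q : CocycleExtension V R) : (p + q).1 = p.1 + q.1 := rfl
@[simp] lemma snd_add (p q : CocycleExtension V R) : (p + q).2 = p.2 + q.2 := rfl
@[simp] lemma fst_smul (c : V) (p : CocycleExtension V R) : (c • p).1 = c • p.1 := rfl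
@[simp] lemma snd_smul (c : V) (p : CocycleExtension V R) : (c • p).2 = c • p.2 := rfl

end CocycleExtension

end Extension

section QuasiFree

variable {V : Type u} [CommRing V]
variable {R : Type v} [NonUnitalRing R] [Module V R] [IsScalarTower V R R] [SMulCommClass V R R]

namespace CocycleExtension

instance : Mul (CocycleExtension V R) where
  mul p q := (p.1 * q.1,
    (p.1 : Unitization V R) • q.2 + rightMul2 V R p.2 q.1 + (1 ⊗ₜ[V] p.1) ⊗ₜ[V] q.1)

@[simp] lemma fst_mul (p q : CocycleExtension V R) : (p * q).1 = p.1 * q.1 := rfl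
@[simp] lemma snd_mul (p q : CocycleExtension V R) : (p * q).2 =
    (p.1 : Unitization V R) • q.2 + rightMul2 V R p.2 q.1 + (1 ⊗ₜ[V] p.1) ⊗ₜ[V] q.1 := rfl

instance : NonUnitalRing (CocycleExtension V R) where
  left_distrib p q r := by
    ext1
    · simp [mul_add]
    · simp only [snd_mul, snd_add, fst_add, smul_add, map_add, TensorProduct.tmul_add]
      abel
  right_distrib p q r := by
    ext1
    · simp [add_mul]
    · simp only [snd_mul, snd_add, fst_add, Unitization.inr_add, add_smul, map_add,
        LinearMap.add_apply, TensorProduct.tmul_add, TensorProduct.add_tmul]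
      abel
  zero_mul p := by ext1 <;> simp
  mul_zero p := by ext1 <;> simp
  mul_assoc p q r := by
    ext1
    · simp [mul_assoc]
    · simp only [snd_mul, fst_mul, map_add, LinearMap.add_apply, rightMul2_mul, rightMul2_smul,
        smul_add, rightMul2_tmul, rightMul1_tmul, TensorProduct.sub_tmul, one_mul,
        Unitization.inr_mul, mul_smul]
      simp only [TensorProduct.smul_tmul', smul_eq_mul, mul_one]
      abel

instance : IsScalarTower V (CocycleExtension V R) (CocycleExtension V R) where
  smul_assoc c p q := by
    ext1
    · exact smul_mul_assoc c p.1 q.1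
    · simp only [smul_eq_mul, snd_mul, snd_smul, fst_smul, Unitization.inr_smul, smul_assoc,
        map_smul, LinearMap.smul_apply, smul_add, TensorProduct.tmul_smul,
        ← TensorProduct.smul_tmul']

instance : SMulCommClass V (CocycleExtension V R) (CocycleExtension V R) where
  smul_comm c p q := by
    ext1
    · exact (mul_smul_comm c p.1 q.1).symm
    · simp only [smul_eq_mul, snd_mul, snd_smul, fst_smul, map_smul, smul_add,
        TensorProduct.tmul_smul]
      rw [smul_comm]

end CocycleExtension

/-- Splitting the extension of `R` by `Ω²(R)` with cocycle `dx dy` gives a connection. -/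
theorem IsQuasiFree.exists_connection (h : IsQuasiFree V R) : Nonempty (Connection V R) := by
  let p : CocycleExtension V R →ₙₐ[V] R :=
    { toFun := fun q => q.1
      map_smul' := fun _ _ => rfl
      map_zero' := rfl
      map_add' := fun _ _ => rfl
      map_mul' := fun _ _ => rfl }
  let σ : R →ₗ[V] CocycleExtension V R := LinearMap.inl V R (Omega2 V R)
  obtain ⟨s, hs⟩ := h (CocycleExtension V R) p σ (fun _ => rfl) (by
    intro x y (hx : x.1 = 0) (hy : y.1 = 0)
    ext1 <;> simp [hx, hy])
  let φ : R →ₗ[V] Omega2 V R :=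
    { toFun := fun x => (s x).2
      map_add' := fun x y => by rw [map_add]; rfl
      map_smul' := fun c x => by rw [map_smul]; rfl }
  replace hs : ∀ x, (s x).1 = x := hs
  refine ⟨Connection.ofLeibniz φ fun y a => ?_⟩
  change (s (y * a)).2 = _
  rw [map_mul, CocycleExtension.snd_mul, hs, hs]
  rfl

end QuasiFree

/-! ### Ideals that are locally generated by a nonzerodivisor -/

section LocalIdeals

variable {B : Type*} [CommRing B] (I P : Ideal B) [P.IsPrime]

lemma algebraMap_mem_iff_mul_mem {s : B} (hs : s ∉ P) (z : B)
    (K : Ideal (Localization.AtPrime P)) :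
    algebraMap B (Localization.AtPrime P) (s * z) ∈ K ↔
      algebraMap B (Localization.AtPrime P) z ∈ K := by
  have hu : IsUnit (algebraMap B (Localization.AtPrime P) s) :=
    IsLocalization.map_units (M := P.primeCompl) _ ⟨s, hs⟩
  rw [map_mul, Ideal.unit_mul_mem_iff_mem _ hu]

variable {I P}

lemma projective_map_of_not_le (h : ¬ I ≤ P) :
    Module.Projective (Localization.AtPrime P)
      (I.map (algebraMap B (Localization.AtPrime P))) := by
  obtain ⟨s, hsI, hsP⟩ := Set.not_subset.1 h
  have e : I.map (algebraMap B (Localization.AtPrime P)) = ⊤ :=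
    Ideal.eq_top_of_isUnit_mem _ (Ideal.mem_map_of_mem _ hsI)
      (IsLocalization.map_units (M := P.primeCompl) _ ⟨s, hsP⟩)
  rw [e]
  exact Module.Projective.of_equiv (Submodule.topEquiv (R := Localization.AtPrime P)).symm

/-- Nakayama: an ideal that is generated by `f` modulo its square, locally at `P`, is generated
by `f` locally at `P`. -/
lemma map_eq_span_singleton [IsNoetherianRing B] (hIP : I ≤ P) {f : B} (hf : f ∈ I)
    (h : ∀ z ∈ I, ∃ s ∉ P, ∃ c, s * z - c * f ∈ I ^ 2) :
    I.map (algebraMap B (Localization.AtPrime P)) =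
      Ideal.span {algebraMap B (Localization.AtPrime P) f} := by
  set A := Localization.AtPrime P
  set J := I.map (algebraMap B A) with hJ
  have hfJ : algebraMap B A f ∈ J := Ideal.mem_map_of_mem _ hf
  refine le_antisymm ?_ ((Ideal.span_singleton_le_iff_mem _).2 hfJ)
  have hjac : J ≤ Ideal.jacobson ⊥ := by
    rw [IsLocalRing.jacobson_eq_maximalIdeal ⊥ bot_ne_top,
      ← Localization.AtPrime.map_eq_maximalIdeal]
    exact Ideal.map_mono hIP
  refine Submodule.le_of_le_smul_of_le_jacobson_bot (IsNoetherian.noetherian J) hjac ?_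
  refine Ideal.map_le_iff_le_comap.2 fun z hz => ?_
  obtain ⟨s, hs, c, hc⟩ := h z hz
  rw [Ideal.mem_comap, ← algebraMap_mem_iff_mul_mem P hs]
  have e : algebraMap B A (s * z) =
      algebraMap B A c * algebraMap B A f + algebraMap B A (s * z - c * f) := by
    rw [← map_mul, ← map_add]; congr 1; ring
  rw [e]
  refine add_mem (Ideal.mem_sup_left (Ideal.mul_mem_left _ _ (Ideal.mem_span_singleton_self _)))
    (Ideal.mem_sup_right ?_)
  rw [smul_eq_mul, ← pow_two, hJ, ← Ideal.map_pow]
  exact Ideal.mem_map_of_mem _ hc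

/-- If, locally at `P`, the ideal `I` is generated by `f` modulo its square and the powers `fⁿ`
are independent modulo `I`, then `I` is locally generated by the nonzerodivisor `f`. -/
lemma projective_map_of_generator [IsNoetherianRing B] (hIP : I ≤ P) {f : B} (hf : f ∈ I)
    (h : ∀ z ∈ I, ∃ s ∉ P, ∃ c, s * z - c * f ∈ I ^ 2)
    (h' : ∀ b n, b * f ^ (n + 1) = 0 → ∃ s ∉ P, s * b ∈ I) :
    Module.Projective (Localization.AtPrime P)
      (I.map (algebraMap B (Localization.AtPrime P))) := by
  have hJ := map_eq_span_singleton hIP hf h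
  set A := Localization.AtPrime P
  set g := algebraMap B A f with hg
  have hgP : g ∈ IsLocalRing.maximalIdeal A := by
    rw [← Localization.AtPrime.map_eq_maximalIdeal]
    exact Ideal.mem_map_of_mem _ (hIP hf)
  have hstep : ∀ (u : A) n, u * g ^ (n + 1) = 0 → u ∈ Ideal.span {g} := by
    intro u n hu
    obtain ⟨b, s, rfl⟩ := IsLocalization.exists_mk'_eq P.primeCompl u
    rw [IsLocalization.mk'_eq_mul_mk'_one, mul_right_comm, hg, ← map_pow, ← map_mul] at hu
    have hu' : algebraMap B A (b * f ^ (n + 1)) = 0 := by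
      have := congrArg (· * algebraMap B A s) hu
      simpa [mul_assoc, IsLocalization.mk'_spec] using this
    obtain ⟨s', hs'⟩ := (IsLocalization.map_eq_zero_iff P.primeCompl A _).1 hu'
    obtain ⟨s'', hs'', hI⟩ := h' (s' * b) n (by rw [mul_assoc]; exact hs')
    rw [IsLocalization.mk'_eq_mul_mk'_one]
    refine Ideal.mul_mem_right _ _ ?_
    rw [← hJ, ← algebraMap_mem_iff_mul_mem P s'.2, ← algebraMap_mem_iff_mul_mem P hs'']
    exact Ideal.mem_map_of_mem _ hI
  have hreg : ∀ u : A, u * g = 0 → u = 0 := by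
    intro u hu
    -- If `u = v gⁿ`, then `v gⁿ⁺¹ = 0` forces `v` into `(g)`; so `u` lies in all powers of `(g)`.
    have hpow : ∀ n, u ∈ Ideal.span {g} ^ n := by
      intro n
      induction n with
      | zero => simp
      | succ n ih =>
        rw [Ideal.span_singleton_pow, Ideal.mem_span_singleton] at ih ⊢
        obtain ⟨v, rfl⟩ := ih
        have hv := hstep v n (by rw [← hu]; ring)
        obtain ⟨w, rfl⟩ := Ideal.mem_span_singleton.1 hv
        exact ⟨w, by ring⟩
    have hbot := Ideal.iInf_pow_eq_bot_of_isLocalRing (Ideal.span {g})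
      (ne_top_of_le_ne_top (IsLocalRing.maximalIdeal.isMaximal A).ne_top
        ((Ideal.span_singleton_le_iff_mem _).2 hgP))
    exact (Submodule.mem_bot A).1 (hbot ▸ (Submodule.mem_iInf _).2 hpow)
  have hinj : Function.Injective (LinearMap.toSpanSingleton A A g) := by
    rw [injective_iff_map_eq_zero]
    exact fun u hu => hreg u hu
  rw [hJ]
  have e := LinearEquiv.ofInjective _ hinj
  rw [LinearMap.range_toSpanSingleton] at e
  exact Module.Projective.of_equiv e

/-- An ideal that is locally equal to its square vanishes locally, by Nakayama's lemma. -/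
lemma projective_map_of_le_sq [IsNoetherianRing B] (hIP : I ≤ P)
    (h : ∀ z ∈ I, ∃ s ∉ P, s * z ∈ I ^ 2) :
    Module.Projective (Localization.AtPrime P)
      (I.map (algebraMap B (Localization.AtPrime P))) := by
  have hJ := map_eq_span_singleton (f := 0) hIP (zero_mem I) fun z hz => by
    obtain ⟨s, hs, hz⟩ := h z hz
    exact ⟨s, hs, 0, by simpa using hz⟩
  rw [map_zero, Ideal.span_singleton_eq_bot.2 rfl] at hJ
  rw [hJ]
  infer_instance

/-- Ideals of Noetherian rings are finitely presented, so their projectivity is a local property. -/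
lemma projective_ideal_of_localization [IsNoetherianRing B] (I : Ideal B)
    (H : ∀ (P : Ideal B) [P.IsPrime], Module.Projective (Localization.AtPrime P)
      (I.map (algebraMap B (Localization.AtPrime P)))) : Module.Projective B I := by
  have : Module.FinitePresentation B I := Module.finitePresentation_of_finite B I
  exact Module.projective_of_localization_maximal'
    (fun P _ => Localization.AtPrime P)
    (fun P _ => I.map (algebraMap B (Localization.AtPrime P)))
    (fun P _ => Algebra.idealMap (S := Localization.AtPrime P) I)
    (fun P _ => H P)

end LocalIdeals

/-! ### Exponentiating derivations of formally smooth algebras -/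

section PolynomialLift

open Polynomial

variable {k E T : Type*} [CommRing k] [CommRing E] [Algebra k E] [CommRing T] [Algebra k T]
  [Algebra E T] [IsScalarTower k E T]

variable (T) in
/-- The ring `T[X]/(Xⁿ)` of truncated polynomials. -/
abbrev TruncPoly (n : ℕ) : Type _ := T[X] ⧸ Ideal.span {(X : T[X]) ^ n}

lemma mk_eq_mk_iff_coeff {n : ℕ} {p q : T[X]} :
    (Ideal.Quotient.mk (Ideal.span {(X : T[X]) ^ n}) p = Ideal.Quotient.mk _ q) ↔
      ∀ i < n, p.coeff i = q.coeff i := by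
  rw [Ideal.Quotient.eq, Ideal.mem_span_singleton, X_pow_dvd_iff]
  simp [sub_eq_zero]

/-- A derivation `∂` of `T` as the algebra homomorphism `r ↦ r + ∂(r) X` into `T[X]/(X²)`. -/
def derivationToTruncPoly (D : Derivation k T T) : T →ₐ[k] TruncPoly T 2 where
  toFun r := Ideal.Quotient.mk _ (C r + C (D r) * X)
  map_one' := by simp
  map_zero' := by simp
  map_add' r s := by rw [← map_add]; congr 1; simp only [map_add]; ring
  map_mul' r s := by
    rw [← map_mul, Ideal.Quotient.eq, Ideal.mem_span_singleton]
    exact ⟨-(C (D r) * C (D s)), by simp only [D.leibniz, smul_eq_mul, map_add, map_mul]; ring⟩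
  commutes' c := by
    simp only [D.map_algebraMap, map_zero, zero_mul, add_zero]
    rfl

/-- A derivation `D` of a formally smooth algebra exponentiates modulo every power of `X`: the
homomorphism `r ↦ r + D(r) X` lifts along `T[X]/(Xⁿ⁺²) → T[X]/(X²)`, whose kernel is nilpotent. -/
lemma exists_lift_derivation [Algebra.FormallySmooth k T] (D : Derivation k T T) (n : ℕ) :
    ∃ τ : T →ₐ[k] TruncPoly T (n + 2), ∀ r, ∃ p : T[X],
      τ r = Ideal.Quotient.mk _ p ∧ p.coeff 0 = r ∧ p.coeff 1 = D r := by
  have hle : Ideal.span {(X : T[X]) ^ (n + 2)} ≤ Ideal.span {X ^ 2} :=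
    Ideal.span_singleton_le_span_singleton.2 (pow_dvd_pow X (by omega))
  let π : TruncPoly T (n + 2) →ₐ[k] TruncPoly T 2 := Ideal.Quotient.factorₐ k hle
  have hπ : Function.Surjective π := Ideal.Quotient.factor_surjective hle
  have hnil : IsNilpotent (RingHom.ker (π : TruncPoly T (n + 2) →+* TruncPoly T 2)) := by
    refine ⟨n + 2, ?_⟩
    have hker : RingHom.ker (π : TruncPoly T (n + 2) →+* TruncPoly T 2) =
        Ideal.span {Ideal.Quotient.mk _ (X ^ 2 : T[X])} := by
      ext q
      obtain ⟨q, rfl⟩ := Ideal.Quotient.mk_surjective q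
      have h1 : (π : TruncPoly T (n + 2) →+* TruncPoly T 2) (Ideal.Quotient.mk _ q) =
        Ideal.Quotient.mk _ q := rfl
      rw [RingHom.mem_ker, h1, Ideal.Quotient.eq_zero_iff_mem, Ideal.mem_span_singleton,
        Ideal.mem_span_singleton]
      constructor
      · rintro ⟨c, rfl⟩
        exact ⟨Ideal.Quotient.mk _ c, by simp⟩
      · rintro ⟨c, hc⟩
        obtain ⟨c, rfl⟩ := Ideal.Quotient.mk_surjective c
        rw [← map_mul, Ideal.Quotient.eq, Ideal.mem_span_singleton] at hc
        obtain ⟨d, hd⟩ := hc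
        exact ⟨c + X ^ n * d, by rw [sub_eq_iff_eq_add] at hd; rw [hd]; ring⟩
    rw [hker, Ideal.span_singleton_pow, ← map_pow, ← pow_mul]
    refine Ideal.span_singleton_eq_bot.2 ?_
    rw [Ideal.Quotient.eq_zero_iff_mem, Ideal.mem_span_singleton]
    exact pow_dvd_pow X (by omega)
  refine ⟨Algebra.FormallySmooth.liftOfSurjective (derivationToTruncPoly D) π hπ hnil,
    fun r => ?_⟩
  obtain ⟨p, hp⟩ := Ideal.Quotient.mk_surjective
    (Algebra.FormallySmooth.liftOfSurjective (derivationToTruncPoly D) π hπ hnil r)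
  have h := Algebra.FormallySmooth.liftOfSurjective_apply (derivationToTruncPoly D) π hπ hnil r
  rw [← hp] at h
  replace h : Ideal.Quotient.mk (Ideal.span {(X : T[X]) ^ 2}) p =
    Ideal.Quotient.mk _ (C r + C (D r) * X) := h
  rw [mk_eq_mk_iff_coeff] at h
  exact ⟨p, hp.symm, by simpa using h 0 (by omega), by simpa [coeff_C] using h 1 (by omega)⟩

/-- Let `f` in the kernel of `E ⊗ E → E` be mapped to a unit by the linear functional attached to
a derivation of a formally smooth localisation `T`. Then the powers of `f` are independent modulo
the kernel, locally: exponentiating the derivation gives homomorphisms `E ⊗ E → T[X]/(Xⁿ)` that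
map `f` to a unit multiple of `X`. -/
lemma algebraMap_lmul'_eq_zero [Algebra.FormallySmooth k T] (D : Derivation k T T)
    {f : E ⊗[k] E} (hf : f ∈ KaehlerDifferential.ideal k E)
    (hfD : IsUnit ((D.compAlgebraMap E).tensorProductTo f)) (b : E ⊗[k] E) (n : ℕ)
    (hb : b * f ^ (n + 1) = 0) :
    algebraMap E T (Algebra.TensorProduct.lmul' k b) = 0 := by
  obtain ⟨τ, hτ⟩ := exists_lift_derivation D n
  let Θ : E ⊗[k] E →ₐ[k] TruncPoly T (n + 2) := Algebra.TensorProduct.productMap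
    ((IsScalarTower.toAlgHom k T (TruncPoly T (n + 2))).comp (IsScalarTower.toAlgHom k E T))
    (τ.comp (IsScalarTower.toAlgHom k E T))
  have hΘ : ∀ z, ∃ p : T[X], Θ z = Ideal.Quotient.mk _ p ∧
      p.coeff 0 = algebraMap E T (Algebra.TensorProduct.lmul' k z) ∧
      p.coeff 1 = (D.compAlgebraMap E).tensorProductTo z := by
    intro z
    induction z using TensorProduct.induction_on with
    | zero => exact ⟨0, by simp⟩
    | add x y hx hy =>
      obtain ⟨p, hp, hp0, hp1⟩ := hx
      obtain ⟨q, hq, hq0, hq1⟩ := hy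
      exact ⟨p + q, by rw [map_add, map_add, hp, hq], by simp [hp0, hq0], by simp [hp1, hq1]⟩
    | tmul x y =>
      obtain ⟨p, hp, hp0, hp1⟩ := hτ (algebraMap E T y)
      refine ⟨C (algebraMap E T x) * p, ?_, by simp [hp0], ?_⟩
      · rw [map_mul, ← hp]
        exact Algebra.TensorProduct.productMap_apply_tmul _ _ x y
      · rw [coeff_C_mul, hp1, Derivation.tensorProductTo_tmul, Algebra.smul_def]
        rfl
  obtain ⟨p, hp, hp0, -⟩ := hΘ b
  obtain ⟨q, hq, hq0, hq1⟩ := hΘ f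
  rw [RingHom.mem_ker.1 hf, map_zero] at hq0
  obtain ⟨q, rfl⟩ := X_dvd_iff.2 hq0
  have h := congrArg Θ hb
  rw [map_zero, map_mul, map_pow, hp, hq, ← map_pow, ← map_mul, Ideal.Quotient.eq_zero_iff_mem,
    Ideal.mem_span_singleton, X_pow_dvd_iff] at h
  -- The coefficient of `Xⁿ⁺¹` in `p (X q)ⁿ⁺¹` is `p(0) q(0)ⁿ⁺¹`, and `q(0)` is a unit.
  have h1 := h (n + 1) (by omega)
  rw [mul_pow, mul_left_comm, coeff_X_pow_mul', if_pos le_rfl, Nat.sub_self, mul_coeff_zero,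
    coeff_zero_eq_eval_zero (q ^ _), eval_pow, ← coeff_zero_eq_eval_zero, hp0] at h1
  rw [mul_comm, coeff_mul_X] at hq1
  exact ((hq1 ▸ hfD).pow (n + 1)).mul_left_eq_zero.1 h1

end PolynomialLift

/-! ### The diagonal ideal at a prime -/

section Diagonal

variable {k E : Type*} [CommRing k] [CommRing E] [Algebra k E] (T : Type*) [CommRing T]
  [Algebra k T] [Algebra E T] [IsScalarTower k E T]

lemma fromIdeal_tmul_one_mul (x : E) (z : KaehlerDifferential.ideal k E) :
    KaehlerDifferential.fromIdeal k E ((x ⊗ₜ[k] (1 : E)) • z) =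
      x • KaehlerDifferential.fromIdeal k E z := by
  rw [map_smul]
  exact algebraMap_smul (E ⊗[k] E) x _

lemma mem_sq_of_fromIdeal_eq_zero {z : KaehlerDifferential.ideal k E}
    (h : KaehlerDifferential.fromIdeal k E z = 0) :
    (z : E ⊗[k] E) ∈ KaehlerDifferential.ideal k E ^ 2 :=
  (Ideal.toCotangent_eq_zero _ z).1 h

lemma pow_tmul_one_notMem {P : Ideal (E ⊗[k] E)} [P.IsPrime] {t : E} (ht : t ⊗ₜ[k] 1 ∉ P)
    (n : ℕ) : (t ^ n) ⊗ₜ[k] 1 ∉ P := by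
  have e : (t ^ n) ⊗ₜ[k] (1 : E) = (t ⊗ₜ[k] 1) ^ n := by
    rw [Algebra.TensorProduct.tmul_pow, one_pow]
  rw [e]
  exact fun h => ht (Ideal.IsPrime.mem_of_pow_mem ‹_› n h)

/-- Where the differentials of a localisation vanish, the diagonal ideal equals its square, hence
vanishes locally. -/
lemma projective_diagonal_of_subsingleton [IsNoetherianRing (E ⊗[k] E)] (t : E)
    [IsLocalization.Away t T] [Subsingleton Ω[T⁄k]] {P : Ideal (E ⊗[k] E)} [P.IsPrime]
    (hP : KaehlerDifferential.ideal k E ≤ P) (ht : t ⊗ₜ[k] 1 ∉ P) :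
    Module.Projective (Localization.AtPrime P)
      ((KaehlerDifferential.ideal k E).map (algebraMap _ (Localization.AtPrime P))) := by
  refine projective_map_of_le_sq hP fun z hz => ?_
  obtain ⟨⟨_, n, rfl⟩, hn⟩ := (IsLocalizedModule.eq_zero_iff (Submonoid.powers t)
    (KaehlerDifferential.map k k E T)
    (m := KaehlerDifferential.fromIdeal k E ⟨z, hz⟩)).1 (Subsingleton.elim _ _)
  refine ⟨(t ^ n) ⊗ₜ 1, pow_tmul_one_notMem ht n, ?_⟩
  refine mem_sq_of_fromIdeal_eq_zero (z := ((t ^ n) ⊗ₜ[k] (1 : E)) • ⟨z, hz⟩) ?_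
  rw [fromIdeal_tmul_one_mul]
  exact hn

/-- The functional on the diagonal ideal attached to a derivation `D` of `T` factors through the
Kähler differentials of `T`. -/
lemma map_fromIdeal (D : Derivation k T T) (z : KaehlerDifferential.ideal k E) :
    D.liftKaehlerDifferential (KaehlerDifferential.map k k E T
      (KaehlerDifferential.fromIdeal k E z)) = (D.compAlgebraMap E).tensorProductTo z := by
  rw [← Derivation.liftKaehlerDifferential_apply]
  change (D.liftKaehlerDifferential.restrictScalars E ∘ₗ KaehlerDifferential.map k k E T) _ =
    (D.compAlgebraMap E).liftKaehlerDifferential (KaehlerDifferential.fromIdeal k E z)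
  congr 1
  ext x
  simp

/-- Where the differentials of a formally smooth localisation are free of rank one, the diagonal
ideal of `E ⊗ E` is locally generated by a nonzerodivisor: an element lifting a generator of the
differentials. -/
lemma projective_diagonal_of_equiv [IsNoetherianRing (E ⊗[k] E)] (t : E)
    [IsLocalization.Away t T] [Algebra.FormallySmooth k T] (e : Ω[T⁄k] ≃ₗ[T] T)
    {P : Ideal (E ⊗[k] E)} [P.IsPrime]
    (hP : KaehlerDifferential.ideal k E ≤ P) (ht : t ⊗ₜ[k] 1 ∉ P) :
    Module.Projective (Localization.AtPrime P)
      ((KaehlerDifferential.ideal k E).map (algebraMap _ (Localization.AtPrime P))) := by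
  let D : Derivation k T T := e.toLinearMap.compDer (KaehlerDifferential.D k T)
  have hD : D.liftKaehlerDifferential = e.toLinearMap := by
    ext x
    simp [D]
  have hunit : ∀ n : ℕ, IsUnit (algebraMap E T (t ^ n)) := fun n =>
    IsLocalization.map_units (M := Submonoid.powers t) T ⟨t ^ n, n, rfl⟩
  obtain ⟨⟨η, _, m, rfl⟩, hη⟩ := IsLocalizedModule.surj (Submonoid.powers t)
    (KaehlerDifferential.map k k E T) (e.symm 1)
  obtain ⟨f, rfl⟩ := KaehlerDifferential.fromIdeal_surjective k E η
  have hη' : e (KaehlerDifferential.map k k E T (KaehlerDifferential.fromIdeal k E f)) =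
      algebraMap E T (t ^ m) := by
    rw [← hη, Submonoid.smul_def, ← algebraMap_smul T, map_smul, e.apply_symm_apply, smul_eq_mul,
      mul_one]
  have hfD : (D.compAlgebraMap E).tensorProductTo (f : E ⊗[k] E) = algebraMap E T (t ^ m) := by
    rw [← map_fromIdeal, hD]
    exact hη'
  refine projective_map_of_generator hP f.2 (fun z hz => ?_) (fun b n hb => ?_)
  · -- `e [z] / t ^ m = c / t ^ j`, so `t ^ j [z] = c [f]` up to a power of `t`.
    obtain ⟨⟨c, _, j, rfl⟩, hc⟩ := IsLocalization.surj (Submonoid.powers t)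
      (e (KaehlerDifferential.map k k E T (KaehlerDifferential.fromIdeal k E ⟨z, hz⟩)) *
        ((hunit m).unit⁻¹ : Tˣ))
    have h0 : KaehlerDifferential.map k k E T
        (t ^ j • KaehlerDifferential.fromIdeal k E ⟨z, hz⟩ -
          c • KaehlerDifferential.fromIdeal k E f) = 0 := by
      apply e.injective
      rw [map_sub, map_smul, map_smul, ← algebraMap_smul T (t ^ j), ← algebraMap_smul T c, map_sub,
        map_smul, map_smul, hη', smul_eq_mul, smul_eq_mul, map_zero, sub_eq_zero]
      dsimp only at hc
      rw [← hc, mul_right_comm, mul_assoc _ _ (algebraMap E T (t ^ m)), IsUnit.val_inv_mul,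
        mul_one, mul_comm]
    obtain ⟨⟨_, i, rfl⟩, hi⟩ := (IsLocalizedModule.eq_zero_iff (Submonoid.powers t) _).1 h0
    refine ⟨(t ^ (i + j)) ⊗ₜ 1, pow_tmul_one_notMem ht _, (t ^ i * c) ⊗ₜ 1, ?_⟩
    refine mem_sq_of_fromIdeal_eq_zero (z := ((t ^ (i + j)) ⊗ₜ[k] (1 : E)) • ⟨z, hz⟩ -
      ((t ^ i * c) ⊗ₜ[k] (1 : E)) • f) ?_
    rw [map_sub, fromIdeal_tmul_one_mul, fromIdeal_tmul_one_mul, pow_add, mul_smul, mul_smul,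
      ← smul_sub]
    exact hi
  · have h0 := algebraMap_lmul'_eq_zero D f.2 (hfD ▸ hunit m) b n hb
    obtain ⟨⟨_, i, rfl⟩, hi⟩ := (IsLocalization.map_eq_zero_iff (Submonoid.powers t) T _).1 h0
    refine ⟨(t ^ i) ⊗ₜ 1, pow_tmul_one_notMem ht _, ?_⟩
    rw [RingHom.mem_ker, map_mul]
    simpa using hi

end Diagonal

/-! ### The diagonal ideal of the unitalisation of a smooth curve -/

section Smooth

variable {V : Type u} [CommRing V] {R : Type v} [CommRing R] [Algebra V R]

lemma nonempty_equiv_of_relativeDimension_one (T : Type*) [CommRing T] [Algebra V T]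
    [Nontrivial T] [Algebra.IsStandardSmoothOfRelativeDimension 1 V T] :
    Nonempty (Ω[T⁄V] ≃ₗ[T] T) := by
  have : Algebra.IsStandardSmooth V T :=
    Algebra.IsStandardSmoothOfRelativeDimension.isStandardSmooth 1
  refine nonempty_linearEquiv_of_rank_eq ?_
  rw [Algebra.IsStandardSmoothOfRelativeDimension.rank_kaehlerDifferential 1, Module.rank_self,
    Nat.cast_one]

variable (V R) in
/-- The projection `R⁺ → R`, `r + c ↦ r + c · 1`, for a unital algebra `R`. -/
def unitizationProj : Unitization V R →ₐ[V] R := Unitization.lift (NonUnitalAlgHom.id V R)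

lemma unitizationProj_apply (x : Unitization V R) :
    unitizationProj V R x = algebraMap V R x.fst + x.snd := by
  simp [unitizationProj]

lemma unitizationProj_inr (r : R) : unitizationProj V R (r : Unitization V R) = r := by
  simp [unitizationProj]

/-- The isomorphism `R⁺ ≅ V × R` for a unital algebra `R`. -/
def unitizationEquivProd : Unitization V R ≃ₐ[V] V × R :=
  AlgEquiv.ofBijective ((Unitization.fstHom V R).prod (unitizationProj V R)) <| by
    constructor
    · intro x y h
      have h1 : x.fst = y.fst := (Prod.ext_iff.1 h).1
      have h2 : unitizationProj V R x = unitizationProj V R y := (Prod.ext_iff.1 h).2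
      rw [unitizationProj_apply, unitizationProj_apply, h1] at h2
      exact Unitization.ext h1 (add_left_cancel h2)
    · rintro ⟨c, r⟩
      refine ⟨Unitization.inl c + ((r - algebraMap V R c : R) : Unitization V R), ?_⟩
      refine Prod.ext ?_ ?_
      · change (Unitization.inl c + ((r - algebraMap V R c : R) : Unitization V R)).fst = c
        rw [Unitization.fst_add, Unitization.fst_inl, Unitization.fst_inr, add_zero]
      · change unitizationProj V R _ = r
        rw [unitizationProj_apply, Unitization.fst_add, Unitization.snd_add, Unitization.fst_inl,
          Unitization.fst_inr, Unitization.snd_inl, Unitization.snd_inr, add_zero, zero_add,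
          add_sub_cancel]

instance [Algebra.FiniteType V R] : Algebra.FiniteType V (Unitization V R) :=
  Algebra.FiniteType.equiv inferInstance unitizationEquivProd.symm

/-- For `R` smooth of relative dimension one, the diagonal ideal of `R⁺ ⊗ R⁺` is projective. The
differentials of `R⁺ ≅ V × R` have rank one over `R` and rank zero over `V`. -/
theorem projective_diagonal_unitization [IsNoetherianRing V]
    (h : IsSmoothOfRelativeDimension 1 V R) :
    Module.Projective (Unitization V R ⊗[V] Unitization V R)
      (KaehlerDifferential.ideal V (Unitization V R)) := by
  obtain ⟨hR, s, hs, hst⟩ := h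
  have : Algebra.FiniteType V (Unitization V R ⊗[V] Unitization V R) :=
    Algebra.FiniteType.trans (S := Unitization V R) inferInstance inferInstance
  have : IsNoetherianRing (Unitization V R ⊗[V] Unitization V R) :=
    Algebra.FiniteType.isNoetherianRing V _
  refine projective_ideal_of_localization _ fun P _ => ?_
  by_cases hP : KaehlerDifferential.ideal V (Unitization V R) ≤ P
  swap
  · exact projective_map_of_not_le hP
  by_cases h1 : (((1 : R) : Unitization V R) ⊗ₜ[V] (1 : Unitization V R)) ∈ P
  · -- The prime lies on the component `V` of `R⁺ ≅ V × R`, where the differentials vanish.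
    let : Algebra (Unitization V R) V := (Unitization.fstHom V R).toRingHom.toAlgebra
    have : IsScalarTower V (Unitization V R) V := IsScalarTower.of_algebraMap_eq fun _ => rfl
    have hid : IsIdempotentElem (1 - ((1 : R) : Unitization V R)) :=
      IsIdempotentElem.one_sub (by
        change ((1 : R) : Unitization V R) * ((1 : R) : Unitization V R) = _
        rw [← Unitization.inr_mul, one_mul])
    have : IsLocalization.Away (1 - ((1 : R) : Unitization V R)) V := by
      refine IsLocalization.away_of_isIdempotentElem_of_mul hid (fun x y => ?_)
        fun c => ⟨Unitization.inl c, rfl⟩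
      change x.fst = y.fst ↔ _
      have key : ∀ z : Unitization V R, (1 - ((1 : R) : Unitization V R)) * z =
          z.fst • (1 - ((1 : R) : Unitization V R)) := fun z => by
        induction z using Unitization.ind with
        | inl_add_inr c r =>
          rw [mul_add, sub_mul, sub_mul, one_mul, one_mul, Unitization.inr_mul_inl,
            ← Unitization.inr_mul, one_mul, sub_self, add_zero, smul_sub,
            Unitization.inr_smul]
          congr 1 <;> ext <;> simp
      rw [key, key]
      constructor
      · intro h
        rw [h]
      · intro h
        have h' := congrArg (Unitization.fstHom V R) h
        rw [map_smul, map_smul, map_sub, map_one, Unitization.fstHom_apply,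
          Unitization.fst_inr, sub_zero, smul_eq_mul, smul_eq_mul, mul_one, mul_one] at h'
        exact h'
    have : Subsingleton Ω[V⁄V] :=
      KaehlerDifferential.subsingleton_of_surjective V V Function.surjective_id
    refine projective_diagonal_of_subsingleton V (1 - ((1 : R) : Unitization V R)) hP fun h2 => ?_
    refine Ideal.IsPrime.ne_top ‹_› ((Ideal.eq_top_iff_one P).2 ?_)
    have := add_mem h1 h2
    rwa [← TensorProduct.add_tmul, add_sub_cancel] at this
  · -- The prime lies on the component `R`, hence over one of the charts `Localization.Away t`.
    obtain ⟨t, hts, ht⟩ : ∃ t ∈ s, ((t : R) : Unitization V R) ⊗ₜ[V] (1 : Unitization V R) ∉ P := by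
      by_contra! hcon
      let Q : Ideal R :=
        { carrier := {r | (r : Unitization V R) ⊗ₜ[V] (1 : Unitization V R) ∈ P}
          add_mem' := fun {a b} ha hb => by
            have := add_mem (s := P) ha hb
            rwa [← TensorProduct.add_tmul, ← Unitization.inr_add] at this
          zero_mem' := by simp
          smul_mem' := fun c x hx => by
            have := P.mul_mem_left ((c : Unitization V R) ⊗ₜ[V] (1 : Unitization V R)) hx
            rwa [Algebra.TensorProduct.tmul_mul_tmul, ← Unitization.inr_mul, one_mul] at this }
      have hQ : Ideal.span s ≤ Q := Ideal.span_le.2 hcon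
      rw [hs] at hQ
      exact h1 (hQ (Submodule.mem_top (x := (1 : R))))
    have hsm := hst t hts
    let : Algebra (Unitization V R) R := (unitizationProj V R).toRingHom.toAlgebra
    have : IsScalarTower V (Unitization V R) R :=
      IsScalarTower.of_algebraMap_eq fun c => ((unitizationProj V R).commutes c).symm
    have : IsScalarTower V (Unitization V R) (Localization.Away t) :=
      IsScalarTower.of_algebraMap_eq fun c => by
        rw [IsScalarTower.algebraMap_apply (Unitization V R) R, ← IsScalarTower.algebraMap_apply V,
          ← IsScalarTower.algebraMap_apply V]
    have hid : IsIdempotentElem ((1 : R) : Unitization V R) := by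
      change ((1 : R) : Unitization V R) * ((1 : R) : Unitization V R) = _
      rw [← Unitization.inr_mul, one_mul]
    have : IsLocalization.Away ((1 : R) : Unitization V R) R := by
      refine IsLocalization.away_of_isIdempotentElem_of_mul hid (fun x y => ?_)
        fun r => ⟨r, unitizationProj_inr r⟩
      change unitizationProj V R x = unitizationProj V R y ↔ _
      have key : ∀ z : Unitization V R, ((1 : R) : Unitization V R) * z =
          ((unitizationProj V R z : R) : Unitization V R) := fun z => by
        ext <;> simp [unitizationProj, Algebra.smul_def, add_comm]
      rw [key, key, Unitization.inr_injective.eq_iff]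
    have : IsLocalization.Away (algebraMap (Unitization V R) R t) (Localization.Away t) := by
      rw [show algebraMap (Unitization V R) R t = t from unitizationProj_inr t]
      infer_instance
    have : IsLocalization.Away ((t : R) : Unitization V R) (Localization.Away t) := by
      have := IsLocalization.Away.mul R (Localization.Away t) ((1 : R) : Unitization V R)
        ((t : R) : Unitization V R)
      rwa [← Unitization.inr_mul, mul_one] at this
    rcases subsingleton_or_nontrivial (Localization.Away t) with hT | hT
    · have : Subsingleton Ω[Localization.Away t⁄V] :=
        Module.subsingleton (Localization.Away t) _
      exact projective_diagonal_of_subsingleton (Localization.Away t) _ hP ht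
    · obtain ⟨e⟩ := nonempty_equiv_of_relativeDimension_one (V := V) (Localization.Away t)
      exact projective_diagonal_of_equiv (Localization.Away t) _ e hP ht

end Smooth

/-! ### Connections from projectivity of the diagonal ideal -/

section Projective

variable {V : Type u} [CommRing V] {R : Type v} [CommRing R] [Algebra V R]

variable (V R) in
/-- The universal differential `y ↦ 1 ⊗ y - y ⊗ 1` from `R` to the diagonal ideal of `R⁺ ⊗ R⁺`. -/
def diagonalD : R →ₗ[V] KaehlerDifferential.ideal V (Unitization V R) where
  toFun y := ⟨1 ⊗ₜ[V] (y : Unitization V R) - (y : Unitization V R) ⊗ₜ[V] 1,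
    KaehlerDifferential.one_smul_sub_smul_one_mem_ideal V _⟩
  map_add' y z := by
    ext1
    simp only [Unitization.inr_add, TensorProduct.tmul_add, TensorProduct.add_tmul,
      Submodule.coe_add]
    abel
  map_smul' c y := by
    ext1
    simp only [Unitization.inr_smul, TensorProduct.tmul_smul, ← TensorProduct.smul_tmul']
    exact (smul_sub c _ _).symm

lemma coe_diagonalD (y : R) : (diagonalD V R y : Unitization V R ⊗[V] Unitization V R) =
    1 ⊗ₜ[V] (y : Unitization V R) - (y : Unitization V R) ⊗ₜ[V] 1 := rfl

lemma diagonalD_mul (y a : R) : diagonalD V R (y * a) =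
    ((y : Unitization V R) ⊗ₜ[V] (1 : Unitization V R)) • diagonalD V R a +
      ((1 : Unitization V R) ⊗ₜ[V] (a : Unitization V R)) • diagonalD V R y := by
  ext1
  simp only [Submodule.coe_add, Submodule.coe_smul, coe_diagonalD, smul_eq_mul, mul_sub,
    Algebra.TensorProduct.tmul_mul_tmul, one_mul, mul_one, Unitization.inr_mul]
  rw [mul_comm (a : Unitization V R)]
  abel

variable (V R) in
/-- The `R⁺`-bimodule map `R⁺ ⊗ R⁺ ⊗ R → ker (R⁺ ⊗ R⁺ → R⁺)`, `x ⊗ u ⊗ y ↦ x (dy) u`. -/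
def diagonalCover : (Unitization V R ⊗[V] Unitization V R) ⊗[V] R
    →ₗ[Unitization V R ⊗[V] Unitization V R] KaehlerDifferential.ideal V (Unitization V R) :=
  (diagonalD V R).liftBaseChange _

lemma diagonalCover_tmul (b : Unitization V R ⊗[V] Unitization V R) (y : R) :
    diagonalCover V R (b ⊗ₜ y) = b • diagonalD V R y := by
  simp [diagonalCover]

lemma diagonalCover_surjective : Function.Surjective (diagonalCover V R) := by
  rintro ⟨z, hz⟩
  suffices h : KaehlerDifferential.ideal V (Unitization V R) ≤
      (LinearMap.range (diagonalCover V R)).map (Submodule.subtype _) by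
    obtain ⟨_, ⟨w, rfl⟩, hw⟩ := h hz
    exact ⟨w, Subtype.ext hw⟩
  conv_lhs => rw [← KaehlerDifferential.span_range_eq_ideal]
  refine Submodule.span_le.2 ?_
  rintro _ ⟨x, rfl⟩
  induction x using Unitization.ind with
  | inl_add_inr c r =>
    refine ⟨diagonalD V R r, ⟨1 ⊗ₜ r, by rw [diagonalCover_tmul, one_smul]⟩, ?_⟩
    have hc : (Unitization.inl c : Unitization V R) = c • 1 := by ext <;> simp
    simp only [Submodule.subtype_apply, coe_diagonalD, hc, TensorProduct.tmul_add,
      TensorProduct.add_tmul, TensorProduct.tmul_smul, ← TensorProduct.smul_tmul']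
    abel

variable (V R) in
/-- The map `x ⊗ u ↦ x d(u)` with `d 1 = 0`; on the diagonal ideal it is the inverse of
`x dy ↦ x (1 ⊗ y - y ⊗ 1)`. -/
def toOmega1 : Unitization V R ⊗[V] Unitization V R →ₗ[V] Omega1 V R :=
  LinearMap.lTensor _ (Unitization.sndHom V V R)

variable (V R) in
/-- The map `x ⊗ u ⊗ y ↦ x dy d(u)` with `d 1 = 0`. -/
def toOmega2 : (Unitization V R ⊗[V] Unitization V R) ⊗[V] R →ₗ[V] Omega2 V R :=
  LinearMap.lTensor _ (Unitization.sndHom V V R) ∘ₗ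
    (TensorProduct.rightComm V (Unitization V R) (Unitization V R) R).toLinearMap

lemma toOmega1_tmul (x u : Unitization V R) : toOmega1 V R (x ⊗ₜ u) = x ⊗ₜ u.snd := by
  simp [toOmega1]

lemma toOmega2_tmul (x u : Unitization V R) (y : R) :
    toOmega2 V R ((x ⊗ₜ u) ⊗ₜ y) = (x ⊗ₜ y) ⊗ₜ u.snd := by
  simp [toOmega2]

lemma toOmega2_left (y : R) (w : (Unitization V R ⊗[V] Unitization V R) ⊗[V] R) :
    toOmega2 V R (((y : Unitization V R) ⊗ₜ[V] (1 : Unitization V R)) • w) =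
      (y : Unitization V R) • toOmega2 V R w := by
  induction w using TensorProduct.induction_on with
  | zero => simp only [smul_zero, LinearMap.map_zero]
  | add w w' h h' => simp only [smul_add, map_add, h, h']
  | tmul b z =>
    induction b using TensorProduct.induction_on with
    | zero => simp only [smul_zero, LinearMap.map_zero, TensorProduct.zero_tmul]
    | add b b' h h' => simp only [TensorProduct.add_tmul, smul_add, map_add, h, h']
    | tmul x u =>
      rw [TensorProduct.smul_tmul', smul_eq_mul, Algebra.TensorProduct.tmul_mul_tmul, one_mul,
        toOmega2_tmul, toOmega2_tmul, TensorProduct.smul_tmul', TensorProduct.smul_tmul',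
        smul_eq_mul]

/-- The failure of `x ⊗ u ⊗ y ↦ x dy du` to be right linear is the Leibniz term of a connection. -/
lemma toOmega2_right (a : R) (w : (Unitization V R ⊗[V] Unitization V R) ⊗[V] R) :
    toOmega2 V R (((1 : Unitization V R) ⊗ₜ[V] (a : Unitization V R)) • w) =
      rightMul2 V R (toOmega2 V R w) a + toOmega1 V R (diagonalCover V R w) ⊗ₜ[V] a := by
  induction w using TensorProduct.induction_on with
  | zero => simp only [smul_zero, LinearMap.map_zero, LinearMap.zero_apply,
      TensorProduct.zero_tmul, Submodule.coe_zero, add_zero]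
  | add w w' h h' =>
    simp only [smul_add, map_add, h, h', LinearMap.add_apply, Submodule.coe_add,
      TensorProduct.add_tmul]
    abel
  | tmul b z =>
    induction b using TensorProduct.induction_on with
    | zero => simp only [smul_zero, LinearMap.map_zero, LinearMap.zero_apply,
      TensorProduct.zero_tmul, Submodule.coe_zero, add_zero]
    | add b b' h h' =>
      simp only [TensorProduct.add_tmul, smul_add, map_add, h, h', LinearMap.add_apply,
        Submodule.coe_add]
      abel
    | tmul x u =>
      rw [TensorProduct.smul_tmul', smul_eq_mul, Algebra.TensorProduct.tmul_mul_tmul, one_mul,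
        toOmega2_tmul, toOmega2_tmul, diagonalCover_tmul, Submodule.coe_smul, coe_diagonalD,
        smul_eq_mul, mul_sub, Algebra.TensorProduct.tmul_mul_tmul,
        Algebra.TensorProduct.tmul_mul_tmul, mul_one, mul_one, map_sub, toOmega1_tmul,
        toOmega1_tmul, rightMul2_tmul, rightMul1_tmul]
      have h₁ : ((a : Unitization V R) * u).snd = u.fst • a + u.snd * a := by
        simp [mul_comm]
      have h₂ : (u * (z : Unitization V R)).snd = u.fst • z + z * u.snd := by
        simp [mul_comm]
      rw [h₁, h₂]
      simp only [TensorProduct.tmul_add, TensorProduct.sub_tmul, TensorProduct.add_tmul,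
        TensorProduct.tmul_smul, TensorProduct.smul_tmul']
      abel

/-- A bimodule section of `x ⊗ u ⊗ y ↦ x (dy) u` composed with `x ⊗ u ⊗ y ↦ x dy du` is a
connection. -/
theorem exists_connection_of_projective
    [Module.Projective (Unitization V R ⊗[V] Unitization V R)
      (KaehlerDifferential.ideal V (Unitization V R))] : Nonempty (Connection V R) := by
  obtain ⟨s, hs⟩ := Module.projective_lifting_property (diagonalCover V R) LinearMap.id
    diagonalCover_surjective
  refine ⟨Connection.ofLeibniz
    (toOmega2 V R ∘ₗ s.restrictScalars V ∘ₗ diagonalD V R) fun y a => ?_⟩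
  have hs' : diagonalCover V R (s (diagonalD V R y)) = diagonalD V R y := LinearMap.congr_fun hs _
  have hd : toOmega1 V R (diagonalD V R y) = 1 ⊗ₜ y := by
    rw [coe_diagonalD, map_sub, toOmega1_tmul, toOmega1_tmul]
    simp
  change toOmega2 V R (s (diagonalD V R (y * a))) =
    (y : Unitization V R) • toOmega2 V R (s (diagonalD V R a)) +
      rightMul2 V R (toOmega2 V R (s (diagonalD V R y))) a + (1 ⊗ₜ[V] y) ⊗ₜ[V] a
  rw [diagonalD_mul, LinearMap.map_add, LinearMap.map_smul, LinearMap.map_smul, LinearMap.map_add,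
    toOmega2_left, toOmega2_right, hs', hd, add_assoc]

/-- To generate a unital algebra as a non-unital algebra, the unit is added to the generators. -/
lemma exists_finite_adjoin_eq_top [Algebra.FiniteType V R] :
    ∃ S : Set R, S.Finite ∧ NonUnitalAlgebra.adjoin V S = ⊤ := by
  obtain ⟨S, hS⟩ := ‹Algebra.FiniteType V R›.out
  refine ⟨insert 1 S, (S.finite_toSet).insert 1, ?_⟩
  refine eq_top_iff.2 fun x _ => ?_
  have hx : x ∈ Algebra.adjoin V (S : Set R) := hS ▸ trivial
  have h1 : (1 : R) ∈ NonUnitalAlgebra.adjoin V (insert 1 (S : Set R)) :=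
    NonUnitalAlgebra.subset_adjoin V (Set.mem_insert _ _)
  induction hx using Algebra.adjoin_induction with
  | mem x hx => exact NonUnitalAlgebra.subset_adjoin V (Set.mem_insert_of_mem _ hx)
  | algebraMap c => rw [Algebra.algebraMap_eq_smul_one]; exact SMulMemClass.smul_mem c h1
  | add x y _ _ hx hy => exact add_mem (hx trivial) (hy trivial)
  | mul x y _ _ hx hy => exact mul_mem (hx trivial) (hy trivial)

end Projective

end NCForms

end

theorem mainTheorem10 (V : Type u) [CommRing V] [IsDomain V] [IsDiscreteValuationRing V]
    [IsAdicComplete (IsLocalRing.maximalIdeal V) V] :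
    (∀ (R : Type v) [CommRing R] [Algebra V R],
      NCForms.IsSmoothOfRelativeDimension 1 V R →
      ∃ D : NCForms.Connection V R, D.HasFiniteDegree) ∧
    (∀ (R : Type v) [NonUnitalRing R] [Module V R] [IsScalarTower V R R] [SMulCommClass V R R]
      (S : Set R), S.Finite → NonUnitalAlgebra.adjoin V S = ⊤ →
      NCForms.IsQuasiFree V R →
      NCForms.IsFilteredNoetherian
        (NCForms.wordFiltration V (NCForms.envelopingGenerators V S)) →
      ∃ D : NCForms.Connection V R, D.HasFiniteDegree) := by
  refine ⟨fun R _ _ hR => ?_, fun R _ _ _ _ S hfin hS hqf _ => ?_⟩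
  · have := NCForms.projective_diagonal_unitization hR
    have := hR.1
    obtain ⟨D⟩ := NCForms.exists_connection_of_projective (V := V) (R := R)
    obtain ⟨S, hfin, hS⟩ := NCForms.exists_finite_adjoin_eq_top (V := V) (R := R)
    exact ⟨D, D.hasFiniteDegree_of_adjoin_eq_top hfin hS⟩
  · obtain ⟨D⟩ := hqf.exists_connection
    exact ⟨D, D.hasFiniteDegree_of_adjoin_eq_top hfin hS⟩
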